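/- Let $T$ be a non-empty string of length $n$ over an arbitrary alphabet $\Sigma$. Define the following quantities. * $\gamma^*$ is the size of a smallest *string attractor* of $T$, that is, of a set $\Gamma$ of positions of $T$ such that every non-empty substring $T[i..j]$ has an occurrence $T[i'..j']=T[i..j]$ with $p\in[i',j']$ for some $p\in\Gamma$. * $b^*$ is the size (number of directives) of a smallest *macro scheme* of $T$, that is, of a finite set of directives $T[i..j]\leftarrow T[i'..j']$ (copy, with $j-i=j'-i'$) and $T[i]\leftarrow c$ (assign the character $c\in\Sigma$) from which $T$ can be unambiguously reconstructed: from each position some finite chain of copies ends in an assigned character, and every such chain ends in the correct character. * $g^*$ is the size of a smallest *straight-line program* (SLP) generating $T$, that is, of an acyclic context-free grammar with one rule per nonterminal, all rules being of the form $X\to AB$ or $X\to a$ ($A,B$ nonterminals, $a\in\Sigma$); $g^*_{rl}$ is the size of a smallest *run-length SLP* generating $T$, where rules $X\to A^\ell$ with $\ell>2$ are allowed too. The size of a grammar is the number of its rules. * $z$ is the number of phrases of the Lempel–Ziv (LZ77) factorization of $T$ without self-references and without trailing characters: scanning from left to right, the next phrase is the longest prefix of the remaining suffix that occurs entirely inside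 the part already parsed, or a single character if that character has not occurred before. Write $\log^+ x=\max\{1,\log_2 x\}$. There is an absolute constant $C>0$ such that for every alphabet and every non-empty string $T$: 1. $b^*\le C\,\gamma^*\log^+(n/\gamma^*)$, i.e. $b^*\in\mathcal O(\gamma^*\log(n/\gamma^*))$; 2. each of $g^*$, $g^*_{rl}$ and $z$ is at most $C\,\gamma^*\bigl(\log^+(n/\gamma^*)\bigr)^2$, i.e. $g^*,g^*_{rl},z\in\mathcal O(\gamma^*\log^2(n/\gamma^*))$. -/

import Mathlib

universe u

/-! A string over the alphabet `α` is a list `T : List α`; positions are counted from `0`, so the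
positions of `T` are the natural numbers `< T.length`. -/

section Strings

variable {α : Type u}

/-- The substring `T[i..j]`, both end points included. -/
def substr (T : List α) (i j : ℕ) : List α := (T.drop i).take (j + 1 - i)

end Strings

/-! ### String attractors -/

section Attractors

variable {α : Type u}

/-- `Γ` is a string attractor of `T`: a set of positions of `T` such that every (non-empty)
substring of `T` has an occurrence that contains a position of `Γ`. -/
def IsStringAttractor (T : List α) (Γ : Finset ℕ) : Prop :=
  (∀ p ∈ Γ, p < T.length) ∧
  ∀ i j, i ≤ j → j < T.length →
    ∃ i' j', i' ≤ j' ∧ j' < T.length ∧ substr T i' j' = substr T i j ∧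
      ∃ p ∈ Γ, i' ≤ p ∧ p ≤ j'

/-- `γ*`: the size of a smallest string attractor. -/
noncomputable def gammaStar (T : List α) : ℕ :=
  sInf {k | ∃ Γ : Finset ℕ, IsStringAttractor T Γ ∧ Γ.card = k}

/-- The minimum is attained. -/
theorem gammaStar_attained (T : List α) :
    ∃ Γ : Finset ℕ, IsStringAttractor T Γ ∧ Γ.card = gammaStar T := by
  refine Nat.sInf_mem (s := {k | ∃ Γ : Finset ℕ, IsStringAttractor T Γ ∧ Γ.card = k})
    ⟨_, Finset.range T.length, ⟨fun p hp => Finset.mem_range.1 hp, ?_⟩, rfl⟩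
  intro i j hij hj
  exact ⟨i, j, hij, hj, rfl, j, Finset.mem_range.2 hj, hij, le_rfl⟩

end Attractors

/-! ### Macro schemes -/

/-- The directives of a macro scheme:
`copy i j i' j'` is `T[i..j] ← T[i'..j']`, and `assign i c` is `T[i] ← c`. -/
inductive Directive (α : Type u) : Type u
  | copy (i j i' j' : ℕ) : Directive α
  | assign (i : ℕ) (c : α) : Directive α

namespace Directive

variable {α : Type u}

/-- The directive speaks about non-empty ranges of positions `< n`, and the two ranges of a copy
directive have the same length. -/
def InRange (n : ℕ) : Directive α → Prop
  | copy i j i' j' => i ≤ j ∧ j < n ∧ i' ≤ j' ∧ j' < n ∧ j - i = j' - i'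
  | assign i _ => i < n

end Directive

section MacroSchemes

variable {α : Type u}

/-- `Retrieves D p c`: following the directives of `D`, a finite chain of copies that starts in
position `p` ends in an explicitly stored character `c`. -/
inductive Retrieves (D : Finset (Directive α)) : ℕ → α → Prop
  | assign {i : ℕ} {c : α} : Directive.assign i c ∈ D → Retrieves D i c
  | copy {i j i' j' p : ℕ} {c : α} : Directive.copy i j i' j' ∈ D → i ≤ p → p ≤ j →
      Retrieves D (i' + (p - i)) c → Retrieves D p c

/-- `D` is a macro scheme of `T`: its directives reconstruct `T` unambiguously, that is, the
character retrieved at a position of `T` exists, is unique, and is the character of `T` there. -/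
def IsMacroScheme (T : List α) (D : Finset (Directive α)) : Prop :=
  (∀ d ∈ D, d.InRange T.length) ∧
  ∀ p, p < T.length → ∀ c, Retrieves D p c ↔ T[p]? = some c

/-- `b*`: the number of directives of a smallest macro scheme. -/
noncomputable def bStar (T : List α) : ℕ :=
  sInf {k | ∃ D : Finset (Directive α), IsMacroScheme T D ∧ D.card = k}

/-- The minimum is attained. -/
theorem bStar_attained (T : List α) :
    ∃ D : Finset (Directive α), IsMacroScheme T D ∧ D.card = bStar T := by
  classical
  have hmem : ∀ d : Directive α,
      d ∈ (Finset.univ.image fun i : Fin T.length => Directive.assign i.1 (T.get i)) ↔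
        ∃ i : Fin T.length, Directive.assign i.1 (T.get i) = d := by
    intro d; simp
  refine Nat.sInf_mem (s := {k | ∃ D : Finset (Directive α), IsMacroScheme T D ∧ D.card = k})
    ⟨_, Finset.univ.image fun i : Fin T.length => Directive.assign i.1 (T.get i), ⟨?_, ?_⟩, rfl⟩
  · intro d hd
    obtain ⟨i, rfl⟩ := (hmem d).1 hd
    exact i.2
  · intro p hp c
    constructor
    · intro h
      cases h with
      | assign h =>
        obtain ⟨i, hi⟩ := (hmem _).1 h
        cases hi
        simp
      | copy h =>
        obtain ⟨i, hi⟩ := (hmem _).1 h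
        cases hi
    · intro h
      refine Retrieves.assign ((hmem _).2 ⟨⟨p, hp⟩, ?_⟩)
      rw [List.getElem?_eq_getElem hp] at h
      simpa using h

end MacroSchemes

/-! ### Straight-line programs -/

/-- Right-hand sides of the rules of a (run-length) straight-line program with nonterminals in
`N`: `X → a`, `X → A B`, and `X → A^ℓ` with `ℓ > 2`. -/
inductive SLPRhs (α : Type u) (N : Type) : Type u
  | terminal (a : α) : SLPRhs α N
  | pair (A B : N) : SLPRhs α N
  | power (A : N) (ℓ : ℕ) (hℓ : 2 < ℓ) : SLPRhs α N

/-- The nonterminal `B` occurs in the right-hand side. -/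
def SLPRhs.Mentions {α : Type u} {N : Type} : SLPRhs α N → N → Prop
  | terminal _, _ => False
  | pair A A', B => B = A ∨ B = A'
  | power A _ _, B => B = A

/-- A run-length straight-line program: an acyclic context-free grammar with exactly one rule for
each nonterminal. Its size is the number of its rules, equivalently of its nonterminals. -/
structure RLSLP (α : Type u) : Type u where
  size : ℕ
  rhs : Fin size → SLPRhs α (Fin size)
  start : Fin size
  acyclic : WellFounded fun B A : Fin size => (rhs A).Mentions B

namespace RLSLP

variable {α : Type u}

/-- `G.Expands A w`: the nonterminal `A` of `G` derives the string `w`. -/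
inductive Expands (G : RLSLP α) : Fin G.size → List α → Prop
  | terminal {A : Fin G.size} {a : α} : G.rhs A = SLPRhs.terminal a → Expands G A [a]
  | pair {A B C : Fin G.size} {v w : List α} : G.rhs A = SLPRhs.pair B C →
      Expands G B v → Expands G C w → Expands G A (v ++ w)
  | power {A B : Fin G.size} {ℓ : ℕ} {hℓ : 2 < ℓ} {v : List α} :
      G.rhs A = SLPRhs.power B ℓ hℓ → Expands G B v →
      Expands G A (List.replicate ℓ v).flatten

/-- `G` generates the string `T`. -/
def Generates (G : RLSLP α) (T : List α) : Prop := G.Expands G.start T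

/-- `G` is a straight-line program: it has no run-length rule. -/
def IsSLP (G : RLSLP α) : Prop := ∀ A B ℓ hℓ, G.rhs A ≠ SLPRhs.power B ℓ hℓ

/-- A nonterminal derives at most one string. -/
theorem Expands.unique {G : RLSLP α} {A : Fin G.size} {v w : List α}
    (hv : G.Expands A v) (hw : G.Expands A w) : v = w := by
  induction hv generalizing w with
  | terminal h => cases hw <;> simp_all
  | pair h _ _ ih1 ih2 =>
    cases hw with
    | terminal h' => simp_all
    | pair h' h1 h2 =>
      rw [h] at h'; cases h'
      rw [ih1 h1, ih2 h2]
    | power h' h1 => simp_all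
  | power h _ ih =>
    cases hw with
    | terminal h' => simp_all
    | pair h' h1 h2 => simp_all
    | power h' h1 =>
      rw [h] at h'; cases h'
      rw [ih h1]

/-- Every non-empty string is generated by a straight-line program. -/
theorem exists_isSLP_generates (T : List α) (hT : T ≠ []) :
    ∃ G : RLSLP α, G.IsSLP ∧ G.Generates T := by
  have hm : 0 < T.length := List.length_pos_iff.2 hT
  let m := T.length
  let rhs : Fin (m + m) → SLPRhs α (Fin (m + m)) := fun X =>
    if h : X.1 < m then SLPRhs.terminal (T[X.1]'h)
    else if X.1 = m then SLPRhs.terminal (T[0]'hm)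
    else SLPRhs.pair ⟨X.1 - 1, by omega⟩ ⟨X.1 - m, by omega⟩
  have hac : WellFounded fun B A : Fin (m + m) => (rhs A).Mentions B := by
    refine Subrelation.wf (r := fun B A : Fin (m + m) => B.1 < A.1) ?_
      (measure fun A : Fin (m + m) => A.1).wf
    intro B A h
    simp only [rhs] at h
    split_ifs at h with h1 h2
    · exact h.elim
    · exact h.elim
    · have h3 : 0 < m := hm
      rcases h with rfl | rfl
      · show A.1 - 1 < A.1
        omega
      · show A.1 - m < A.1
        omega
  let G : RLSLP α := ⟨m + m, rhs, ⟨m + (m - 1), by have : 0 < m := hm; omega⟩, hac⟩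
  refine ⟨G, ?_, ?_⟩
  · intro A B ℓ hℓ h
    change rhs A = _ at h
    simp only [rhs] at h
    split_ifs at h
  · have hterm : ∀ i (hi : i < m), G.Expands ⟨i, by show i < m + m; omega⟩ [T[i]'hi] := by
      intro i hi
      refine Expands.terminal ?_
      show rhs _ = _
      simp [rhs, hi]
    have key : ∀ i (hi : i < m),
        G.Expands ⟨m + i, by show m + i < m + m; omega⟩ (T.take (i + 1)) := by
      intro i
      induction i with
      | zero =>
        intro hi
        have : T.take (0 + 1) = [T[0]'hi] := by
          rw [List.take_succ_eq_append_getElem hi]; simp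
        rw [this]
        refine Expands.terminal ?_
        show rhs _ = _
        simp [rhs]
      | succ i ih =>
        intro hi
        rw [List.take_succ_eq_append_getElem hi]
        refine Expands.pair (B := ⟨m + i, by show m + i < m + m; omega⟩)
          (C := ⟨i + 1, by show i + 1 < m + m; omega⟩) ?_ (ih (by omega)) (hterm (i + 1) hi)
        show rhs _ = _
        simp [rhs]
    have h := key (m - 1) (by have : 0 < m := hm; omega)
    have h2 : T.take (m - 1 + 1) = T := by
      apply List.take_of_length_le
      show T.length ≤ T.length - 1 + 1
      omega
    rw [h2] at h
    exact h

end RLSLP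

section GrammarSizes

variable {α : Type u}

/-- `g*`: the size of a smallest straight-line program that generates `T`. -/
noncomputable def gStar (T : List α) : ℕ :=
  sInf {k | ∃ G : RLSLP α, G.IsSLP ∧ G.Generates T ∧ G.size = k}

/-- `g*_rl`: the size of a smallest run-length straight-line program that generates `T`. -/
noncomputable def grlStar (T : List α) : ℕ :=
  sInf {k | ∃ G : RLSLP α, G.Generates T ∧ G.size = k}

/-- The minimum is attained. -/
theorem gStar_attained (T : List α) (hT : T ≠ []) :
    ∃ G : RLSLP α, G.IsSLP ∧ G.Generates T ∧ G.size = gStar T := by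
  obtain ⟨G, h1, h2⟩ := RLSLP.exists_isSLP_generates T hT
  exact Nat.sInf_mem (s := {k | ∃ G : RLSLP α, G.IsSLP ∧ G.Generates T ∧ G.size = k})
    ⟨_, G, h1, h2, rfl⟩

/-- The minimum is attained. -/
theorem grlStar_attained (T : List α) (hT : T ≠ []) :
    ∃ G : RLSLP α, G.Generates T ∧ G.size = grlStar T := by
  obtain ⟨G, _, h2⟩ := RLSLP.exists_isSLP_generates T hT
  exact Nat.sInf_mem (s := {k | ∃ G : RLSLP α, G.Generates T ∧ G.size = k}) ⟨_, G, h2, rfl⟩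

end GrammarSizes

/-! ### The Lempel–Ziv factorization -/

section LempelZiv

variable {α : Type u} [DecidableEq α]

/-- The length of the next Lempel–Ziv phrase, when `v` is still to be parsed and `w` is the part
of the string before it: the length of the longest prefix of `v` that occurs in `w` (so the source
lies entirely before the phrase), or `1` if the first character of `v` does not occur in `w`. -/
def lzPhraseLength (w v : List α) : ℕ :=
  max 1 (Nat.findGreatest (fun ℓ => v.take ℓ <:+: w) v.length)

/-- The greedy Lempel–Ziv parse of `v`, when `w` is the part of the string before it. -/
def lzParse (w v : List α) : List (List α) :=
  if v = [] then []
  else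
    v.take (lzPhraseLength w v) ::
      lzParse (w ++ v.take (lzPhraseLength w v)) (v.drop (lzPhraseLength w v))
termination_by v.length
decreasing_by
  have h1 : 0 < v.length := List.length_pos_iff.2 (by assumption)
  have h2 : 1 ≤ lzPhraseLength w v := le_max_left _ _
  rw [List.length_drop]
  omega

/-- `z`: the number of phrases of the Lempel–Ziv (LZ77) factorization without self-references and
without trailing characters. -/
def lzSize (T : List α) : ℕ := (lzParse [] T).length

end LempelZiv

/-! ### Substrings with half-open bounds -/

section SubstringLemmas

variable {α : Type u}

/-! Let `Γ` be a smallest attractor and `K` the least exponent with `n ≤ |Γ| * 2 ^ K`, so that `K +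
1` is `O(log⁺(n/γ*))`.

For `b*`, store the characters at `Γ` and cover the other positions by intervals no longer than the
distance of their positions to `Γ`: dyadic intervals on both sides of each attractor position, and
`|Γ|` blocks of length `2 ^ K` for the remote positions. Copying an interval from an occurrence that
meets `Γ` brings every position strictly closer to `Γ`, so the chains end. This uses `O(|Γ| (K +
1))` directives (`bStar_le_of_isStringAttractor`).

For the other measures, build a grammar whose nonterminals are strings. The neighbourhoods of radius
`2 ^ k` around attractor positions are derived level by level: a neighbourhood at level `k + 1` is
one at level `k` with a string of length at most `2 ^ k` on either side, and each of these occurs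
inside some neighbourhood at level `k`. Extracting a substring from a derivation of height `h` costs
at most `2 * h` new strings (`Derivable.exists_of_infix`), and the heights are `2 * k`, so the total
is quadratic in `K` per attractor position. Finally `T` is cut into `|Γ|` blocks of length `2 ^ K`,
each extracted from a neighbourhood at level `K` (`IsStringAttractor.exists_derivable`).

The number of distinct strings bounds `g*` (`gStar_le_card`), hence `g*_rl`. It bounds `z` up to one
(`lzSize_le_card_add_one`), because a derivation yields a parse with few phrases and greedy parsing
is optimal. -/

theorem length_substr {T : List α} {i j : ℕ} (hj : j < T.length) :
    (substr T i j).length = j + 1 - i := by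
  simp [substr]; omega

theorem getElem?_substr {T : List α} {i j k : ℕ} (hk : i + k ≤ j) :
    (substr T i j)[k]? = T[i + k]? := by
  rw [substr, List.getElem?_take_of_lt (by omega), List.getElem?_drop]

/-- The substring of `T` at the positions `a ≤ i < b`. -/
def slice (T : List α) (a b : ℕ) : List α := (T.drop a).take (b - a)

theorem slice_append {T : List α} {a b c : ℕ} (hab : a ≤ b) (hbc : b ≤ c) :
    slice T a c = slice T a b ++ slice T b c := by
  have h : c - a = (b - a) + (c - b) := by omega
  have h' : a + (b - a) = b := by omega
  rw [slice, h, List.take_add, List.drop_drop, h', slice, slice]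

theorem slice_infix {T : List α} {a b a' b' : ℕ} (ha : a ≤ a') (hab : a' ≤ b') (hb : b' ≤ b) :
    slice T a' b' <:+: slice T a b := by
  rw [slice_append (b := b') (by omega) hb, slice_append ha hab]
  exact List.infix_append _ _ _

end SubstringLemmas

/-! ### Basic facts on attractors -/

section AttractorLemmas

variable {α : Type u} {T : List α} {Γ : Finset ℕ}

theorem IsStringAttractor.nonempty (h : IsStringAttractor T Γ) (hT : T ≠ []) : Γ.Nonempty := by
  have hm : 0 < T.length := List.length_pos_iff.2 hT
  obtain ⟨_, _, _, _, _, p, hp, _⟩ := h.2 0 0 le_rfl hm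
  exact ⟨p, hp⟩

/-- A substring has an equally long occurrence that contains an attractor position. -/
theorem IsStringAttractor.exists_occurrence (h : IsStringAttractor T Γ) {i j : ℕ}
    (hij : i ≤ j) (hj : j < T.length) :
    ∃ i' j', i' ≤ j' ∧ j' < T.length ∧ j' - i' = j - i ∧ substr T i' j' = substr T i j ∧
      ∃ p ∈ Γ, i' ≤ p ∧ p ≤ j' := by
  obtain ⟨i', j', h1, h2, h3, h4⟩ := h.2 i j hij hj
  refine ⟨i', j', h1, h2, ?_, h3, h4⟩
  have := congrArg List.length h3
  rw [length_substr h2, length_substr hj] at this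
  omega

end AttractorLemmas

/-! ### Macro schemes from attractors -/

section MacroSchemeBound

variable {α : Type u} {T : List α} {Γ : Finset ℕ}

/-- If every position outside the attractor lies in one of the intervals of `J` that is shorter
than the distance of the position to the attractor, then copying each interval from an occurrence
that contains an attractor position gives a macro scheme. -/
theorem bStar_le_card_add_card (hT : T ≠ []) (hΓ : IsStringAttractor T Γ) (J : Finset (ℕ × ℕ))
    (hJ : ∀ x ∈ J, x.1 ≤ x.2 ∧ x.2 < T.length)
    (hcov : ∀ q, q < T.length → q ∉ Γ →
      ∃ x ∈ J, x.1 ≤ q ∧ q ≤ x.2 ∧ ∀ p ∈ Γ, x.2 - x.1 < (q - p) + (p - q)) :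
    bStar T ≤ Γ.card + J.card := by
  classical
  have hm : 0 < T.length := List.length_pos_iff.2 hT
  have hsrc : ∀ x : ℕ × ℕ, ∃ y : ℕ × ℕ, x ∈ J → y.1 ≤ y.2 ∧ y.2 < T.length ∧
      y.2 - y.1 = x.2 - x.1 ∧ substr T y.1 y.2 = substr T x.1 x.2 ∧
      ∃ p ∈ Γ, y.1 ≤ p ∧ p ≤ y.2 := by
    intro x
    by_cases hx : x ∈ J
    · obtain ⟨i', j', h⟩ := hΓ.exists_occurrence (hJ x hx).1 (hJ x hx).2
      exact ⟨(i', j'), fun _ => h⟩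
    · exact ⟨x, fun h => absurd h hx⟩
  choose s hs using hsrc
  -- The second branch only makes `asg` total; attractor positions are always in range.
  let asg : ℕ → Directive α := fun p =>
    if hp : p < T.length then Directive.assign p T[p] else Directive.assign 0 T[0]
  let cpy : ℕ × ℕ → Directive α := fun x => Directive.copy x.1 x.2 (s x).1 (s x).2
  let D : Finset (Directive α) := Γ.image asg ∪ J.image cpy
  have hasg : ∀ p (hp : p < T.length), asg p = Directive.assign p T[p] := fun p hp => by
    simp [asg, hp]
  have hmemA : ∀ i c, Directive.assign i c ∈ D → T[i]? = some c := by
    intro i c h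
    rcases Finset.mem_union.1 h with h | h
    · obtain ⟨p, hp, he⟩ := Finset.mem_image.1 h
      rw [hasg p (hΓ.1 p hp)] at he
      cases he
      simp
    · obtain ⟨x, _, he⟩ := Finset.mem_image.1 h
      cases he
  have hmemC : ∀ i j i' j', Directive.copy i j i' j' ∈ D →
      (i, j) ∈ J ∧ s (i, j) = (i', j') := by
    intro i j i' j' h
    rcases Finset.mem_union.1 h with h | h
    · obtain ⟨p, hp, he⟩ := Finset.mem_image.1 h
      rw [hasg p (hΓ.1 p hp)] at he
      cases he
    · obtain ⟨x, hx, he⟩ := Finset.mem_image.1 h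
      cases he
      exact ⟨hx, rfl⟩
  have hcopy : ∀ x ∈ J, ∀ q, x.1 ≤ q → q ≤ x.2 → T[(s x).1 + (q - x.1)]? = T[q]? := by
    intro x hx q h1 h2
    obtain ⟨a1, a2, a3, a4, _⟩ := hs x hx
    have := hJ x hx
    rw [← getElem?_substr (j := (s x).2) (by omega), a4, getElem?_substr (by omega)]
    congr 1; omega
  have hcard : D.card ≤ Γ.card + J.card :=
    (Finset.card_union_le _ _).trans (add_le_add Finset.card_image_le Finset.card_image_le)
  refine le_trans (Nat.sInf_le ⟨D, ⟨?_, ?_⟩, rfl⟩) hcard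
  · intro d hd
    rcases Finset.mem_union.1 hd with h | h
    · obtain ⟨p, hp, rfl⟩ := Finset.mem_image.1 h
      rw [hasg p (hΓ.1 p hp)]
      exact hΓ.1 p hp
    · obtain ⟨x, hx, rfl⟩ := Finset.mem_image.1 h
      obtain ⟨a1, a2, a3, _⟩ := hs x hx
      exact ⟨(hJ x hx).1, (hJ x hx).2, a1, a2, a3.symm⟩
  -- The intervals may overlap, but every directive respects `T`, so all terminating chains from a
  -- position agree.
  · have hsound : ∀ p c, Retrieves D p c → T[p]? = some c := by
      intro p c h
      induction h with
      | assign h => exact hmemA _ _ h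
      | copy h h1 h2 _ ih =>
        obtain ⟨hx, he⟩ := hmemC _ _ _ _ h
        have := hcopy _ hx _ h1 h2
        rw [he] at this
        rw [← this, ih]
    -- Induction on the distance to `Γ`: the source of an interval contains an attractor position,
    -- so after the copy the distance is at most the interval's length minus one.
    have hcomplete : ∀ d q (hq : q < T.length), (∃ p ∈ Γ, (q - p) + (p - q) ≤ d) →
        Retrieves D q T[q] := by
      intro d
      induction d using Nat.strong_induction_on with
      | _ d ih =>
        rintro q hq ⟨p, hp, hd⟩
        by_cases hqΓ : q ∈ Γ
        · refine Retrieves.assign (Finset.mem_union_left _ (Finset.mem_image.2 ⟨q, hqΓ, ?_⟩))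
          exact hasg q hq
        · obtain ⟨x, hx, h1, h2, h3⟩ := hcov q hq hqΓ
          obtain ⟨a1, a2, a3, a4, p', hp', h4, h5⟩ := hs x hx
          have h6 := h3 p hp
          have h7 := hcopy x hx q h1 h2
          have hq' : (s x).1 + (q - x.1) < T.length := by omega
          have h8 := ih (x.2 - x.1) (by omega) _ hq' ⟨p', hp', by omega⟩
          rw [List.getElem?_eq_getElem hq', List.getElem?_eq_getElem hq] at h7
          rw [Option.some.inj h7] at h8
          exact Retrieves.copy (Finset.mem_union_right _ (Finset.mem_image_of_mem cpy hx)) h1 h2 h8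
    intro q hq c
    refine ⟨hsound q c, fun h => ?_⟩
    obtain ⟨p, hp⟩ := hΓ.nonempty hT
    have := hcomplete _ q hq ⟨p, hp, le_rfl⟩
    rw [List.getElem?_eq_getElem hq] at h
    rwa [← Option.some.inj h]

/-- Each attractor position pays for itself, `K` intervals on either side and one block, hence the
factor `2 * K + 2`. -/
theorem bStar_le_of_isStringAttractor (hT : T ≠ []) (hΓ : IsStringAttractor T Γ) {K : ℕ}
    (hK : T.length ≤ Γ.card * 2 ^ K) : bStar T ≤ Γ.card * (2 * K + 2) := by
  classical
  have hm : 0 < T.length := List.length_pos_iff.2 hT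
  -- At scale `k` the intervals hold the positions at distance `2 ^ k` to `2 ^ (k + 1) - 1` from
  -- `p`, clipped to the string; those left empty beyond the right end are filtered out of `J`.
  let right : ℕ × ℕ → ℕ × ℕ := fun x =>
    (x.1 + 2 ^ x.2, min (x.1 + 2 ^ (x.2 + 1) - 1) (T.length - 1))
  let left : ℕ × ℕ → ℕ × ℕ := fun x => (x.1 + 1 - 2 ^ (x.2 + 1), x.1 - 2 ^ x.2)
  let block : ℕ → ℕ × ℕ := fun i => (i * 2 ^ K, min (i * 2 ^ K + 2 ^ K - 1) (T.length - 1))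
  let P := Γ ×ˢ Finset.range K
  let J : Finset (ℕ × ℕ) := ((P.image right ∪ P.image left) ∪
    (Finset.range Γ.card).image block).filter fun x => x.1 ≤ x.2 ∧ x.2 < T.length
  have hJ : J.card ≤ Γ.card * K + Γ.card * K + Γ.card := by
    refine (Finset.card_filter_le _ _).trans ?_
    refine (Finset.card_union_le _ _).trans (add_le_add ?_ ?_)
    · refine (Finset.card_union_le _ _).trans (add_le_add ?_ ?_) <;>
      · refine Finset.card_image_le.trans ?_
        simp [P]
    · refine Finset.card_image_le.trans ?_
      simp
  refine (bStar_le_card_add_card hT hΓ J (fun x hx => (Finset.mem_filter.1 hx).2) ?_).trans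
    (by linarith)
  intro q hq hqΓ
  obtain ⟨p, hp, hmin⟩ := Γ.exists_min_image (fun p => (q - p) + (p - q)) (hΓ.nonempty hT)
  have hne : p ≠ q := fun h => hqΓ (h ▸ hp)
  set d := (q - p) + (p - q) with hd
  have hpn := hΓ.1 p hp
  have hK0 : 0 < 2 ^ K := by positivity
  -- A position near `Γ` uses its nearest attractor position at scale `Nat.log 2 d`; a remote one
  -- uses its block, whose length `2 ^ K` is at most `d`.
  rcases lt_or_ge d (2 ^ K) with hdK | hdK
  · have hd0 : d ≠ 0 := by omega
    set k := Nat.log 2 d with hk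
    have h1 : 2 ^ k ≤ d := Nat.pow_log_le_self 2 hd0
    have h2 : d < 2 ^ (k + 1) := Nat.lt_pow_succ_log_self (by norm_num) d
    have hkK : k < K := Nat.log_lt_of_lt_pow hd0 hdK
    have h3 : 2 ^ (k + 1) = 2 ^ k + 2 ^ k := by ring
    have hk0 : 0 < 2 ^ k := by positivity
    have hmem : (p, k) ∈ P := Finset.mem_product.2 ⟨hp, Finset.mem_range.2 hkK⟩
    rcases lt_or_gt_of_ne hne with hlt | hgt
    · refine ⟨right (p, k), Finset.mem_filter.2 ⟨?_, ?_⟩, ?_⟩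
      · exact Finset.mem_union_left _ (Finset.mem_union_left _ (Finset.mem_image_of_mem _ hmem))
      · simp only [right]; omega
      · refine ⟨?_, ?_, fun p' hp' => lt_of_lt_of_le ?_ (hmin p' hp')⟩ <;>
          simp only [right] <;> omega
    · refine ⟨left (p, k), Finset.mem_filter.2 ⟨?_, ?_⟩, ?_⟩
      · exact Finset.mem_union_left _ (Finset.mem_union_right _ (Finset.mem_image_of_mem _ hmem))
      · simp only [left]; omega
      · refine ⟨?_, ?_, fun p' hp' => lt_of_lt_of_le ?_ (hmin p' hp')⟩ <;>
          simp only [left] <;> omega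
  · have hi : q / 2 ^ K < Γ.card := by
      rw [Nat.div_lt_iff_lt_mul hK0]; omega
    have h1 : q / 2 ^ K * 2 ^ K ≤ q := Nat.div_mul_le_self _ _
    have h2 : q < q / 2 ^ K * 2 ^ K + 2 ^ K := Nat.lt_div_mul_add hK0
    refine ⟨block (q / 2 ^ K), Finset.mem_filter.2 ⟨?_, ?_⟩, ?_⟩
    · exact Finset.mem_union_right _ (Finset.mem_image_of_mem _ (Finset.mem_range.2 hi))
    · simp only [block]; omega
    · refine ⟨?_, ?_, fun p' hp' => lt_of_lt_of_le ?_ (hmin p' hp')⟩ <;>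
        simp only [block] <;> omega

end MacroSchemeBound

/-! ### Derivations over a set of strings, and extraction of substrings -/

section Derivations

variable {α : Type u}

/-- `Derivable F h w`: the string `w` is obtained by concatenations in a binary tree of height at
most `h`, all of whose non-empty nodes are labelled with strings of `F`. -/
inductive Derivable (F : Finset (List α)) : ℕ → List α → Prop
  | nil (h : ℕ) : Derivable F h []
  | single {a : α} (h : ℕ) : [a] ∈ F → Derivable F h [a]
  | append {h : ℕ} {u v : List α} : u ++ v ∈ F → Derivable F h u → Derivable F h v →
      Derivable F (h + 1) (u ++ v)

namespace Derivable

variable {F : Finset (List α)} {h : ℕ} {w : List α}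

theorem mono {F' : Finset (List α)} {h' : ℕ} (hw : Derivable F h w) (hF : F ⊆ F')
    (hh : h ≤ h') : Derivable F' h' w := by
  induction hw generalizing h' with
  | nil => exact nil _
  | single _ ha => exact single _ (hF ha)
  | append huv _ _ ih1 ih2 =>
    obtain ⟨k, rfl⟩ : ∃ k, h' = k + 1 := ⟨h' - 1, by omega⟩
    exact append (hF huv) (ih1 (by omega)) (ih2 (by omega))

/-- A derivable string of length at least two is the concatenation of two shorter ones. -/
theorem split (hw : Derivable F h w) :
    w = [] ∨ (w ∈ F ∧ ∃ a, w = [a]) ∨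
      (w ∈ F ∧ ∃ u v, w = u ++ v ∧ u ≠ [] ∧ v ≠ [] ∧
        (∃ k, Derivable F k u) ∧ ∃ k, Derivable F k v) := by
  induction hw with
  | nil => exact Or.inl rfl
  | @single a h ha => exact Or.inr (Or.inl ⟨ha, a, rfl⟩)
  | @append h u v huv hu hv ih1 ih2 =>
    by_cases h1 : u = []
    · simpa only [h1, List.nil_append] using ih2
    by_cases h2 : v = []
    · simpa only [h2, List.append_nil] using ih1
    exact Or.inr (Or.inr ⟨huv, u, v, rfl, h1, h2, ⟨_, hu⟩, ⟨_, hv⟩⟩)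

theorem mem (hw : Derivable F h w) (hne : w ≠ []) : w ∈ F := by
  rcases hw.split with h | h | h
  · exact absurd h hne
  · exact h.1
  · exact h.1

variable [DecidableEq α]

/-- The cut follows one path from the root: on each level at most one node is truncated, and its
left siblings are kept whole. -/
theorem exists_of_prefix (hw : Derivable F h w) {x : List α} (hx : x <+: w) :
    ∃ E : Finset (List α), E.card ≤ h ∧ Derivable (F ∪ E) h x := by
  induction hw generalizing x with
  | nil =>
    rw [List.prefix_nil.1 hx]
    exact ⟨∅, by simp, nil _⟩
  | @single a h ha =>
    refine ⟨∅, by simp, ?_⟩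
    rcases x with _ | ⟨b, x⟩
    · exact nil _
    · obtain ⟨rfl, hx'⟩ := List.cons_prefix_cons.1 hx
      obtain rfl := List.prefix_nil.1 hx'
      exact single _ (by simpa using ha)
  | @append h u v huv hu _ ih1 ih2 =>
    obtain ⟨t, ht⟩ := hx
    rcases List.append_eq_append_iff.1 ht with ⟨y, hx, _⟩ | ⟨y, rfl, hy⟩
    · obtain ⟨E, hE, hd⟩ := ih1 ⟨y, hx.symm⟩
      exact ⟨E, by omega, hd.mono subset_rfl (by omega)⟩
    · obtain ⟨E, hE, hd⟩ := ih2 ⟨t, hy.symm⟩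
      refine ⟨insert (u ++ y) E, (Finset.card_insert_le _ _).trans (by omega),
        append (by simp) (hu.mono Finset.subset_union_left le_rfl) (hd.mono ?_ le_rfl)⟩
      exact Finset.union_subset_union_right (Finset.subset_insert _ _)

theorem exists_of_suffix (hw : Derivable F h w) {x : List α} (hx : x <:+ w) :
    ∃ E : Finset (List α), E.card ≤ h ∧ Derivable (F ∪ E) h x := by
  induction hw generalizing x with
  | nil =>
    rw [List.suffix_nil.1 hx]
    exact ⟨∅, by simp, nil _⟩
  | @single a h ha =>
    refine ⟨∅, by simp, ?_⟩
    rcases List.suffix_cons_iff.1 hx with rfl | hx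
    · exact single _ (by simpa using ha)
    · rw [List.suffix_nil.1 hx]
      exact nil _
  | @append h u v huv _ hv ih1 ih2 =>
    obtain ⟨t, ht⟩ := hx
    rcases List.append_eq_append_iff.1 ht with ⟨y, rfl, rfl⟩ | ⟨y, rfl, hx⟩
    · obtain ⟨E, hE, hd⟩ := ih1 (List.suffix_append t y)
      refine ⟨insert (y ++ v) E, (Finset.card_insert_le _ _).trans (by omega),
        append (by simp) (hd.mono ?_ le_rfl) (hv.mono Finset.subset_union_left le_rfl)⟩
      exact Finset.union_subset_union_right (Finset.subset_insert _ _)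
    · obtain ⟨E, hE, hd⟩ := ih2 ⟨y, hx.symm⟩
      exact ⟨E, by omega, hd.mono subset_rfl (by omega)⟩

/-- A substring of a derivable string needs few new strings and no greater height. -/
theorem exists_of_infix (hw : Derivable F h w) {x : List α} (hx : x <:+: w) :
    ∃ E : Finset (List α), E.card ≤ 2 * h ∧ Derivable (F ∪ E) h x := by
  induction hw generalizing x with
  | nil =>
    rw [List.infix_nil.1 hx]
    exact ⟨∅, by simp, nil _⟩
  | @single a h ha =>
    refine ⟨∅, by simp, ?_⟩
    rcases List.infix_cons_iff.1 hx with hx | hx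
    · obtain ⟨E, hE, hd⟩ := (single (F := F) 0 ha).exists_of_prefix hx
      rw [Finset.card_eq_zero.1 (Nat.le_zero.1 hE)] at hd
      exact hd.mono subset_rfl (by omega)
    · rw [List.infix_nil.1 hx]
      exact nil _
  | @append h u v huv hu hv ih1 ih2 =>
    rcases List.infix_append_iff.1 hx with hx | hx | ⟨y, z, rfl, hy, hz⟩
    · obtain ⟨E, hE, hd⟩ := ih1 hx
      exact ⟨E, by omega, hd.mono subset_rfl (by omega)⟩
    · obtain ⟨E, hE, hd⟩ := ih2 hx
      exact ⟨E, by omega, hd.mono subset_rfl (by omega)⟩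
    · obtain ⟨E1, hE1, hd1⟩ := hu.exists_of_suffix hy
      obtain ⟨E2, hE2, hd2⟩ := hv.exists_of_prefix hz
      have hc := Finset.card_union_le E1 E2
      refine ⟨insert (y ++ z) (E1 ∪ E2), (Finset.card_insert_le _ _).trans (by omega),
        append (by simp) (hd1.mono ?_ le_rfl) (hd2.mono ?_ le_rfl)⟩ <;>
      · intro s hs
        simp only [Finset.mem_union, Finset.mem_insert] at hs ⊢
        tauto

/-- Finitely many strings that can be derived separately are derivable together. -/
theorem exists_of_forall {ι : Type*} {s : Finset ι} {f : ι → List α} {c : ℕ}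
    (hs : ∀ i ∈ s, ∃ E : Finset (List α), E.card ≤ c ∧ Derivable (F ∪ E) h (f i)) :
    ∃ E : Finset (List α), E.card ≤ s.card * c ∧ ∀ i ∈ s, Derivable (F ∪ E) h (f i) := by
  have hs' : ∀ i, ∃ E : Finset (List α),
      i ∈ s → E.card ≤ c ∧ Derivable (F ∪ E) h (f i) := fun i => by
    by_cases hi : i ∈ s
    · exact (hs i hi).imp fun E hE _ => hE
    · exact ⟨∅, fun h => absurd h hi⟩
  choose E hE using hs'
  refine ⟨s.biUnion E, Finset.card_biUnion_le_card_mul _ _ _ fun i hi => (hE i hi).1,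
    fun i hi => (hE i hi).2.mono ?_ le_rfl⟩
  exact Finset.union_subset_union_right (Finset.subset_biUnion_of_mem E hi)

end Derivable

end Derivations

/-! ### From derivations to straight-line programs -/

section GrammarOfDerivation

variable {α : Type u}

theorem grlStar_le_gStar {T : List α} (hT : T ≠ []) : grlStar T ≤ gStar T := by
  obtain ⟨G, _, h1, h2⟩ := gStar_attained T hT
  exact Nat.sInf_le ⟨G, h1, h2⟩

/-- The nonterminals are the non-empty derivable strings themselves, with one split chosen for each.
Both parts of a split are strictly shorter, which gives acyclicity whatever trees the splits come
from. -/
theorem gStar_le_card [DecidableEq α] {F : Finset (List α)} {h : ℕ} {T : List α} (hT : T ≠ [])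
    (hd : Derivable F h T) : gStar T ≤ F.card := by
  classical
  let F' : Finset (List α) := F.filter fun w => w ≠ [] ∧ ∃ k, Derivable F k w
  let e := F'.equivFin
  have hmem : ∀ w, w ≠ [] → (∃ k, Derivable F k w) → w ∈ F' := fun w hw hk =>
    Finset.mem_filter.2 ⟨hk.elim fun _ hk => hk.mem hw, hw, hk⟩
  have hrule : ∀ x : F', ∃ r : SLPRhs α (Fin F'.card),
      (∃ a, x.1 = [a] ∧ r = .terminal a) ∨
      ∃ y z : F', x.1 = y.1 ++ z.1 ∧ y.1 ≠ [] ∧ z.1 ≠ [] ∧ r = .pair (e y) (e z) := by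
    rintro ⟨x, hx⟩
    obtain ⟨_, hne, k, hk⟩ := Finset.mem_filter.1 hx
    rcases hk.split with h | ⟨_, a, ha⟩ | ⟨_, u, v, huv, hu, hv, hdu, hdv⟩
    · exact absurd h hne
    · exact ⟨_, Or.inl ⟨a, ha, rfl⟩⟩
    · exact ⟨_, Or.inr ⟨⟨u, hmem u hu hdu⟩, ⟨v, hmem v hv hdv⟩, huv, hu, hv, rfl⟩⟩
  choose r hr using hrule
  let rhs : Fin F'.card → SLPRhs α (Fin F'.card) := fun A => r (e.symm A)
  have hac : WellFounded fun B A : Fin F'.card => (rhs A).Mentions B := by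
    refine Subrelation.wf (r := fun B A : Fin F'.card =>
      (e.symm B).1.length < (e.symm A).1.length) ?_
      (measure fun A : Fin F'.card => (e.symm A).1.length).wf
    intro B A hBA
    rcases hr (e.symm A) with ⟨a, _, h2⟩ | ⟨y, z, h1, hy, hz, h2⟩
    · simp only [rhs, h2, SLPRhs.Mentions] at hBA
    · have hy' := List.length_pos_iff.2 hy
      have hz' := List.length_pos_iff.2 hz
      simp only [rhs, h2, SLPRhs.Mentions] at hBA
      rw [h1, List.length_append]
      rcases hBA with rfl | rfl
      · rw [e.symm_apply_apply]; omega
      · rw [e.symm_apply_apply]; omega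
  let G : RLSLP α := ⟨F'.card, rhs, e ⟨T, hmem T hT ⟨h, hd⟩⟩, hac⟩
  have hexp : ∀ n, ∀ x : F', x.1.length = n → G.Expands (e x) x.1 := by
    intro n
    induction n using Nat.strong_induction_on with
    | _ n ih =>
      intro x hx
      have hG : G.rhs (e x) = r x := by simp [G, rhs]
      rcases hr x with ⟨a, h1, h2⟩ | ⟨y, z, h1, hy, hz, h2⟩
      · rw [h1]
        exact .terminal (hG.trans h2)
      · have hy' := List.length_pos_iff.2 hy
        have hz' := List.length_pos_iff.2 hz
        have hl := congrArg List.length h1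
        rw [List.length_append] at hl
        rw [h1]
        exact .pair (hG.trans h2) (ih _ (by omega) y rfl) (ih _ (by omega) z rfl)
  refine le_trans (Nat.sInf_le ⟨G, ?_, hexp _ ⟨T, _⟩ rfl, rfl⟩) (Finset.card_filter_le _ _)
  intro A B ℓ hℓ hA
  change r (e.symm A) = _ at hA
  rcases hr (e.symm A) with ⟨a, _, h2⟩ | ⟨y, z, _, _, _, h2⟩ <;>
    simp [h2] at hA

end GrammarOfDerivation

/-! ### Lempel–Ziv phrases from derivations -/

section LempelZivBound

variable {α : Type u}

/-- `ParsesInto w v m`: the string `v` is parsed into `m` phrases, each of which is a single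
character or occurs before itself in `w ++ v`, without overlap. -/
inductive ParsesInto : List α → List α → ℕ → Prop
  | nil (w : List α) : ParsesInto w [] 0
  | cons {w x v : List α} {m : ℕ} : x.length = 1 ∨ x <:+: w → ParsesInto (w ++ x) v m →
      ParsesInto w (x ++ v) (m + 1)

theorem ParsesInto.append {w u v : List α} {m k : ℕ} (hu : ParsesInto w u m)
    (hv : ParsesInto (w ++ u) v k) : ParsesInto w (u ++ v) (m + k) := by
  induction hu with
  | nil => simpa using hv
  | @cons w x u m hx _ ih =>
    rw [List.append_assoc, Nat.add_right_comm]
    exact .cons hx (ih (by simpa using hv))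

variable [DecidableEq α]

theorem le_lzPhraseLength {w v x : List α} (hx : x <+: v) (h : x.length = 1 ∨ x <:+: w) :
    x.length ≤ lzPhraseLength w v := by
  rcases h with h | h
  · rw [h]; exact le_max_left _ _
  · refine le_max_of_le_right (Nat.le_findGreatest hx.length_le ?_)
    rwa [← List.prefix_iff_eq_take.1 hx]

/-- The greedy parse has the smallest number of phrases. -/
theorem ParsesInto.length_lzParse_le {w v : List α} {m : ℕ} (hv : ParsesInto w v m)
    {x v' : List α} (hx : v = x ++ v') : (lzParse (w ++ x) v').length ≤ m := by
  induction hv generalizing x v' with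
  | nil =>
    obtain ⟨rfl, rfl⟩ := List.append_eq_nil_iff.1 hx.symm
    rw [lzParse]; simp
  | @cons w y v m hy _ ih =>
    -- Invariant: the greedy parse, having consumed `x`, is never behind the other parse. Either `x`
    -- already covers the phrase `y`, or the unread rest `y'` of `y` is itself admissible, and the
    -- next greedy phrase covers it.
    rcases List.append_eq_append_iff.1 hx with ⟨x', rfl, h2⟩ | ⟨y', rfl, h2⟩
    · have := ih h2
      rw [List.append_assoc] at this
      exact this.trans (Nat.le_succ _)
    · rw [lzParse]
      split_ifs with hnil
      · simp
      · set ℓ := lzPhraseLength (w ++ x) v' with hℓ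
        have h3 : y'.length ≤ ℓ := by
          rcases Nat.eq_zero_or_pos y'.length with h0 | h0
          · omega
          refine le_lzPhraseLength ⟨v, h2.symm⟩ ?_
          rcases hy with hy | hy
          · left
            rw [List.length_append] at hy
            omega
          · right
            exact List.infix_append_right.trans (hy.trans List.infix_append_left)
        have h4 : v'.take ℓ = y' ++ v.take (ℓ - y'.length) := by
          rw [h2, List.take_append, List.take_of_length_le h3]
        have h5 : v = v.take (ℓ - y'.length) ++ v'.drop ℓ := by
          rw [h2, List.drop_append, List.drop_eq_nil_of_le h3, List.nil_append,
            List.take_append_drop]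
        have h6 := ih h5
        rw [List.length_cons, h4]
        simpa using h6

/-- Following a derivation from left to right, only the first occurrence of a string is parsed
into more than one phrase. -/
theorem exists_parsesInto {F : Finset (List α)} (n : ℕ) :
    ∀ (w v : List α) (h : ℕ) (S : Finset (List α)), v.length = n → Derivable F h v → S ⊆ F →
      (∀ s ∈ S, s <:+: w) →
      ∃ (S' : Finset (List α)) (m : ℕ), S ⊆ S' ∧ S' ⊆ F ∧ (∀ s ∈ S', s <:+: w ++ v) ∧
        (∀ s ∈ S', s ∉ S → s.length ≤ n) ∧ ParsesInto w v m ∧ m + S.card ≤ S'.card + 1 := by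
  induction n using Nat.strong_induction_on with
  | _ n ih =>
    intro w v h S hn hd hSF hS
    have hS1 : ∀ s ∈ S, s <:+: w ++ v := fun s hs => (hS s hs).trans List.infix_append_left
    have hone : v.length = 1 ∨ v <:+: w → ParsesInto w v 1 := fun hv => by
      simpa using ParsesInto.cons hv (.nil _)
    rcases hd.split with rfl | ⟨_, a, rfl⟩ | ⟨hvF, u1, u2, rfl, hu1, hu2, ⟨k1, hd1⟩, k2, hd2⟩
    · exact ⟨S, 0, subset_rfl, hSF, hS1, fun s h1 h2 => absurd h1 h2, .nil _, by omega⟩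
    · exact ⟨S, 1, subset_rfl, hSF, hS1, fun s h1 h2 => absurd h1 h2, hone (by simp), by omega⟩
    · by_cases hvS : u1 ++ u2 ∈ S
      · exact ⟨S, 1, subset_rfl, hSF, hS1, fun s h1 h2 => absurd h1 h2,
          hone (Or.inr (hS _ hvS)), by omega⟩
      · have hl1 := List.length_pos_iff.2 hu1
        have hl2 := List.length_pos_iff.2 hu2
        rw [List.length_append] at hn
        obtain ⟨S1, m1, a1, a2, a3, a4, a5, a6⟩ :=
          ih u1.length (by omega) w u1 k1 S rfl hd1 hSF hS
        obtain ⟨S2, m2, b1, b2, b3, b4, b5, b6⟩ :=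
          ih u2.length (by omega) (w ++ u1) u2 k2 S1 rfl hd2 a2 a3
        -- Everything recorded inside the two parts is shorter than the whole, so the whole string
        -- is a fresh element that pays for the extra phrase.
        have hnew : ∀ s ∈ S2, s ∉ S → s.length < n := by
          intro s h1 h2
          by_cases h3 : s ∈ S1
          · have := a4 s h3 h2; omega
          · have := b4 s h1 h3; omega
        have hv2 : u1 ++ u2 ∉ S2 := fun h1 => by
          have := hnew _ h1 hvS
          rw [List.length_append] at this
          omega
        refine ⟨insert (u1 ++ u2) S2, m1 + m2, (a1.trans b1).trans (Finset.subset_insert _ _),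
          Finset.insert_subset hvF b2, ?_, ?_, a5.append b5, ?_⟩
        · intro s hs
          rcases Finset.mem_insert.1 hs with rfl | hs
          · exact List.infix_append_right
          · simpa using b3 s hs
        · intro s hs hsS
          rcases Finset.mem_insert.1 hs with rfl | hs
          · rw [List.length_append]; omega
          · exact (hnew s hs hsS).le
        · rw [Finset.card_insert_of_notMem hv2]; omega

theorem lzSize_le_card_add_one {F : Finset (List α)} {h : ℕ} {T : List α}
    (hd : Derivable F h T) : lzSize T ≤ F.card + 1 := by
  obtain ⟨S', m, _, h2, _, _, h5, h6⟩ :=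
    exists_parsesInto T.length [] T h ∅ rfl hd (Finset.empty_subset _) (by simp)
  have h7 := h5.length_lzParse_le (x := []) rfl
  have h8 := Finset.card_le_card h2
  rw [Finset.card_empty] at h6
  simp only [List.append_nil] at h7
  exact h7.trans (by omega)

end LempelZivBound

/-! ### Small derivations from attractors -/

section AttractorGrammar

variable {α : Type u} {T : List α} {Γ : Finset ℕ}

/-- A short substring occurs in the neighbourhood of some attractor position. -/
theorem IsStringAttractor.exists_slice_infix (hΓ : IsStringAttractor T Γ) (hT : T ≠ [])
    {a b k : ℕ} (hab : b - a ≤ 2 ^ k) :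
    ∃ p ∈ Γ, slice T a b <:+: slice T (p + 1 - 2 ^ k) (p + 2 ^ k) := by
  -- The bound `b` may lie beyond the end of `T`, where `slice` is clipped.
  rcases lt_or_ge a (min b T.length) with h | h
  · obtain ⟨i', j', h1, h2, h3, h4, p, hp, h5, h6⟩ :=
      hΓ.exists_occurrence (i := a) (j := min b T.length - 1) (by omega) (by omega)
    refine ⟨p, hp, ?_⟩
    have h7 : slice T a b = slice T i' (j' + 1) := by
      refine Eq.trans ?_ h4.symm
      simp only [slice, substr]
      rw [List.take_eq_take_iff, List.length_drop]
      omega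
    rw [h7]
    exact slice_infix (by omega) (by omega) (by omega)
  · obtain ⟨p, hp⟩ := hΓ.nonempty hT
    have : slice T a b = [] := by
      rw [slice, List.take_eq_nil_iff, List.drop_eq_nil_iff]
      omega
    exact ⟨p, hp, this ▸ List.nil_infix⟩

variable [DecidableEq α]

/-- Passing from level `k` to `k + 1` costs, per attractor position, two extractions at `2 * (2 *
k)` and two concatenations. This `8 * k + 2` is below the increment `8 * k + 4` of `4 * k ^ 2 + 1`.
-/
theorem IsStringAttractor.exists_derivable_neighbourhoods (hΓ : IsStringAttractor T Γ)
    (hT : T ≠ []) (k : ℕ) :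
    ∃ F : Finset (List α), F.card ≤ Γ.card * (4 * k ^ 2 + 1) ∧
      ∀ p ∈ Γ, Derivable F (2 * k) (slice T (p + 1 - 2 ^ k) (p + 2 ^ k)) := by
  induction k with
  | zero =>
    refine ⟨Γ.image fun p => slice T p (p + 1), Finset.card_image_le.trans (by simp), ?_⟩
    intro p hp
    have hpn := hΓ.1 p hp
    have h1 : slice T p (p + 1) = [T[p]] := by
      rw [slice, List.drop_eq_getElem_cons hpn, Nat.add_sub_cancel_left, List.take_succ_cons,
        List.take_zero]
    have h2 : slice T p (p + 1) ∈ Γ.image fun p => slice T p (p + 1) :=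
      Finset.mem_image_of_mem _ hp
    simp only [pow_zero, Nat.add_sub_cancel]
    rw [h1] at h2 ⊢
    exact .single _ h2
  | succ k ih =>
    obtain ⟨F, hF, hd⟩ := ih
    have hstep : ∀ p ∈ Γ, ∃ E : Finset (List α), E.card ≤ 8 * k + 2 ∧
        Derivable (F ∪ E) (2 * (k + 1)) (slice T (p + 1 - 2 ^ (k + 1)) (p + 2 ^ (k + 1))) := by
      intro p hp
      have hk : 2 ^ (k + 1) = 2 ^ k + 2 ^ k := by ring
      have hk0 : 0 < 2 ^ k := by positivity
      obtain ⟨p1, hp1, h1⟩ := hΓ.exists_slice_infix hT (k := k)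
        (a := p + 1 - 2 ^ (k + 1)) (b := p + 1 - 2 ^ k) (by omega)
      obtain ⟨p2, hp2, h2⟩ := hΓ.exists_slice_infix hT (k := k)
        (a := p + 2 ^ k) (b := p + 2 ^ (k + 1)) (by omega)
      obtain ⟨E1, hE1, hd1⟩ := (hd p1 hp1).exists_of_infix h1
      obtain ⟨E2, hE2, hd2⟩ := (hd p2 hp2).exists_of_infix h2
      rw [slice_append (a := p + 1 - 2 ^ (k + 1)) (b := p + 1 - 2 ^ k) (by omega) (by omega),
        slice_append (a := p + 1 - 2 ^ k) (b := p + 2 ^ k) (by omega) (by omega)]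
      set L := slice T (p + 1 - 2 ^ (k + 1)) (p + 1 - 2 ^ k)
      set W := slice T (p + 1 - 2 ^ k) (p + 2 ^ k)
      set R := slice T (p + 2 ^ k) (p + 2 ^ (k + 1))
      have hc := Finset.card_union_le E1 E2
      have hc1 := Finset.card_insert_le (W ++ R) (E1 ∪ E2)
      refine ⟨insert (L ++ (W ++ R)) (insert (W ++ R) (E1 ∪ E2)),
        (Finset.card_insert_le _ _).trans (by omega),
        .append (h := 2 * k + 1) (by simp) (hd1.mono ?_ (by omega))
          (.append (h := 2 * k) (by simp) ((hd p hp).mono ?_ le_rfl) (hd2.mono ?_ le_rfl))⟩ <;>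
      · intro x hx
        simp only [Finset.mem_union, Finset.mem_insert] at hx ⊢
        tauto
    obtain ⟨E, hE, hdE⟩ := Derivable.exists_of_forall hstep
    refine ⟨F ∪ E, (Finset.card_union_le _ _).trans ?_, hdE⟩
    calc F.card + E.card ≤ Γ.card * (4 * k ^ 2 + 1) + Γ.card * (8 * k + 2) := add_le_add hF hE
      _ ≤ Γ.card * (4 * k ^ 2 + 1) + Γ.card * (8 * k + 4) := by gcongr; omega
      _ = Γ.card * (4 * (k + 1) ^ 2 + 1) := by ring

/-- The blocks are joined from left to right. This may raise the height by `|Γ|`, which is harmless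
because nothing is extracted afterwards. -/
theorem IsStringAttractor.exists_derivable (hΓ : IsStringAttractor T Γ) (hT : T ≠ []) {K : ℕ}
    (hK : T.length ≤ Γ.card * 2 ^ K) :
    ∃ (F : Finset (List α)) (h : ℕ), F.card ≤ 4 * (Γ.card * (K + 1) ^ 2) ∧ Derivable F h T := by
  obtain ⟨F, hF, hd⟩ := hΓ.exists_derivable_neighbourhoods hT K
  have hblock : ∀ i ∈ Finset.range Γ.card, ∃ E : Finset (List α), E.card ≤ 4 * K ∧
      Derivable (F ∪ E) (2 * K) (slice T (i * 2 ^ K) ((i + 1) * 2 ^ K)) := by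
    intro i _
    obtain ⟨p, hp, h1⟩ := hΓ.exists_slice_infix hT (k := K)
      (a := i * 2 ^ K) (b := (i + 1) * 2 ^ K) (by rw [Nat.succ_mul, Nat.add_sub_cancel_left])
    obtain ⟨E, hE, hdE⟩ := (hd p hp).exists_of_infix h1
    exact ⟨E, by omega, hdE⟩
  obtain ⟨E, hE, hdE⟩ := Derivable.exists_of_forall hblock
  have hprefix : ∀ i ≤ Γ.card, ∃ (E' : Finset (List α)), E'.card ≤ i ∧
      Derivable (F ∪ E ∪ E') (2 * K + i) (slice T 0 (i * 2 ^ K)) := by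
    intro i
    induction i with
    | zero => exact fun _ => ⟨∅, by simp, by simpa [slice] using .nil _⟩
    | succ i ih =>
      intro hi
      obtain ⟨E', hE', hd'⟩ := ih (by omega)
      refine ⟨insert (slice T 0 ((i + 1) * 2 ^ K)) E',
        (Finset.card_insert_le _ _).trans (by omega), ?_⟩
      have hsplit : slice T 0 ((i + 1) * 2 ^ K) =
          slice T 0 (i * 2 ^ K) ++ slice T (i * 2 ^ K) ((i + 1) * 2 ^ K) :=
        slice_append (Nat.zero_le _) (Nat.mul_le_mul_right _ (Nat.le_succ _))
      rw [hsplit]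
      refine .append (h := 2 * K + i) (by simp) (hd'.mono ?_ le_rfl)
        ((hdE i (Finset.mem_range.2 (by omega))).mono Finset.subset_union_left (by omega))
      exact Finset.union_subset_union_right (Finset.subset_insert _ _)
  obtain ⟨E', hE', hd'⟩ := hprefix Γ.card le_rfl
  have hwhole : slice T 0 (Γ.card * 2 ^ K) = T := by
    simpa [slice] using hK
  rw [hwhole] at hd'
  refine ⟨_, _, ?_, hd'⟩
  rw [Finset.card_range] at hE
  calc (F ∪ E ∪ E').card ≤ (F ∪ E).card + E'.card := Finset.card_union_le _ _
    _ ≤ F.card + E.card + E'.card := by gcongr; exact Finset.card_union_le _ _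
    _ ≤ Γ.card * (4 * K ^ 2 + 1) + Γ.card * (4 * K) + Γ.card := by gcongr
    _ ≤ 4 * (Γ.card * (K + 1) ^ 2) := by nlinarith [Nat.zero_le (Γ.card * K), Nat.zero_le Γ.card]

end AttractorGrammar

/-- For the least such `K`, if positive, `g * 2 ^ (K - 1) < n`, so `K + 1` exceeds the logarithm by
at most two. -/
theorem exists_le_mul_two_pow {n g : ℕ} (hg : 0 < g) (hn : 0 < n) :
    ∃ K : ℕ, n ≤ g * 2 ^ K ∧ ((K + 1 : ℕ) : ℝ) ≤ 3 * max 1 (Real.logb 2 ((n : ℝ) / g)) := by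
  have hex : ∃ K, n ≤ g * 2 ^ K :=
    ⟨n, (Nat.lt_two_pow_self).le.trans (Nat.le_mul_of_pos_left _ hg)⟩
  classical
  refine ⟨Nat.find hex, Nat.find_spec hex, ?_⟩
  have h1 : (1 : ℝ) ≤ max 1 (Real.logb 2 ((n : ℝ) / g)) := le_max_left _ _
  have h2 : Real.logb 2 ((n : ℝ) / g) ≤ max 1 (Real.logb 2 ((n : ℝ) / g)) := le_max_right _ _
  rcases hK : Nat.find hex with _ | k
  · push_cast; linarith
  · have h3 : g * 2 ^ k < n := not_le.1 (Nat.find_min hex (by omega))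
    have hg' : (0 : ℝ) < g := by exact_mod_cast hg
    have h4 : (k : ℝ) ≤ Real.logb 2 ((n : ℝ) / g) := by
      rw [Real.le_logb_iff_rpow_le (by norm_num) (by positivity), le_div_iff₀ hg',
        Real.rpow_natCast, mul_comm]
      exact_mod_cast h3.le
    push_cast
    linarith

theorem mainTheorem5 :
    ∃ C : ℝ, 0 < C ∧ ∀ (α : Type u) [DecidableEq α] (T : List α), T ≠ [] →
      (bStar T : ℝ) ≤
        C * (gammaStar T * max 1 (Real.logb 2 ((T.length : ℝ) / gammaStar T))) ∧
      (gStar T : ℝ) ≤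
        C * (gammaStar T * max 1 (Real.logb 2 ((T.length : ℝ) / gammaStar T)) ^ 2) ∧
      (grlStar T : ℝ) ≤
        C * (gammaStar T * max 1 (Real.logb 2 ((T.length : ℝ) / gammaStar T)) ^ 2) ∧
      (lzSize T : ℝ) ≤
        C * (gammaStar T * max 1 (Real.logb 2 ((T.length : ℝ) / gammaStar T)) ^ 2) := by
  -- There is slack: the estimates below give 6 for `b*`, 36 for both grammars and 37 for `z`.
  refine ⟨45, by norm_num, fun α _ T hT => ?_⟩
  obtain ⟨Γ, hΓ, hcard⟩ := gammaStar_attained T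
  have hn : 0 < T.length := List.length_pos_iff.2 hT
  have hg : 0 < Γ.card := Finset.card_pos.2 (hΓ.nonempty hT)
  obtain ⟨K, hK, hKL⟩ := exists_le_mul_two_pow hg hn
  rw [hcard] at hKL
  set L : ℝ := max 1 (Real.logb 2 ((T.length : ℝ) / gammaStar T))
  have hL1 : 1 ≤ L := le_max_left _ _
  have hb := bStar_le_of_isStringAttractor hT hΓ hK
  obtain ⟨F, h, hF, hd⟩ := hΓ.exists_derivable hT hK
  rw [hcard] at hb hF hg
  have hγ : (1 : ℝ) ≤ gammaStar T := by exact_mod_cast hg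
  have hF' : (F.card : ℝ) ≤ 36 * (gammaStar T * L ^ 2) := by
    calc (F.card : ℝ) ≤ 4 * (gammaStar T * ((K + 1 : ℕ) : ℝ) ^ 2) := by exact_mod_cast hF
      _ ≤ 4 * (gammaStar T * (3 * L) ^ 2) := by gcongr
      _ = 36 * (gammaStar T * L ^ 2) := by ring
  have hone : 1 ≤ gammaStar T * L ^ 2 := one_le_mul_of_one_le_of_one_le hγ (one_le_pow₀ hL1)
  have hgs : (gStar T : ℝ) ≤ F.card := by exact_mod_cast gStar_le_card hT hd
  have hgrl : (grlStar T : ℝ) ≤ gStar T := by exact_mod_cast grlStar_le_gStar hT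
  have hz : (lzSize T : ℝ) ≤ F.card + 1 := by exact_mod_cast lzSize_le_card_add_one hd
  refine ⟨?_, by linarith, by linarith, by linarith⟩
  calc (bStar T : ℝ) ≤ gammaStar T * (2 * ((K + 1 : ℕ) : ℝ)) := by
        exact_mod_cast hb
    _ ≤ gammaStar T * (2 * (3 * L)) := by gcongr
    _ ≤ 45 * (gammaStar T * L) := by nlinarith [mul_nonneg (zero_le_one.trans hγ) (zero_le_one.trans hL1)]
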